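/- Let $M$ be a metric space with metric $d$ and a fixed base point $0\in M$. Let $\mathrm{Lip}_0(M)$ be the Banach space of all Lipschitz functions $f\colon M\to\mathbb R$ with $f(0)=0$, equipped with the norm $$\|f\|=\sup\Big\{\frac{|f(x)-f(y)|}{d(x,y)} : x,y\in M,\ x\neq y\Big\},$$ and let $B_{\mathrm{Lip}_0(M)}$ be its closed unit ball. Put $\widetilde M=\{(x,y)\in M\times M : x\neq y\}$. For $f\in\mathrm{Lip}_0(M)$ and $(x,y)\in\widetilde M$ write $f(m_{x,y})=\tilde f(x,y)=\frac{f(x)-f(y)}{d(x,y)}$. For $A\subseteq\widetilde M$ let $\pi(A)$ be the set of all points of $M$ that occur as a coordinate of some pair in $A$. Let $ba(\widetilde M)$ be the space of bounded finitely additive signed measures on the power set of $\widetilde M$ with the total variation norm $\|\mu\|=|\mu|(\widetilde M)$, and let $S_{ba(\widetilde M)}$ be its unit sphere. For $\mu\in ba(\widetilde M)$ let $\Phi^*\mu\in \mathrm{Lip}_0(M)^*$ be the functional $(\Phi^*\mu)(f)=\int_{\widetilde M}\tilde f\,d\mu$. Call $\mu$ optimal if $\mu$ is positive and $\|\Phi^*\mu\|=\|\mu\|$.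 A slice of the closed unit ball $B_X$ of a real Banach space $X$ is a set $\{x\in B_X : x^*(x)>1-\alpha\}$ with $x^*\in X^*$, $\|x^*\|=1$ and $\alpha>0$. The space $X$ has the strong diameter $2$ property (SD2P) if for all $n\in\mathbb N$, all slices $S_1,\dots,S_n$ of $B_X$ and all $\lambda_1,\dots,\lambda_n\geq 0$ with $\sum_{i=1}^n\lambda_i=1$, the set $\sum_{i=1}^n\lambda_iS_i$ has diameter $2$. **Proposition.** The space $\mathrm{Lip}_0(M)$ has the SD2P if and only if for every $n\geq 1$, all optimal $\mu_1,\dots,\mu_n\in S_{ba(\widetilde M)}$ and every $\gamma\in(0,1)$, there exist subsets $A_1,\dots,A_n$ of $\widetilde M$ with $\mu_1(A_1)\geq\gamma,\dots,\mu_n(A_n)\geq\gamma$, functions $f_1,g_1,\dots,f_n,g_n\in B_{\mathrm{Lip}_0(M)}$, and points $u,v\in M$ with $u\neq v$ such that, for all $i\in\{1,\dots,n\}$ and $(x,y)\in A_i$, $$f_i(m_{x,y})\geq\gamma\quad\text{and}\quad g_i(m_{x,y})\geq\gamma,$$ and, for all $i\in\{1,\dots,n\}$ and $x,y\in\pi(A_i)$,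 $$\max\{f_i(x)-f_i(y),\,g_i(y)-g_i(x)\}+\gamma\, d(u,v)\leq d(x,u)+d(y,v).$$ -/

import Mathlib

open scoped ENNReal NNReal Pointwise

namespace LipSD2P

universe u

/-! ### Slices and the strong diameter 2 property -/

section SD2P

variable {X : Type u} [NormedAddCommGroup X] [NormedSpace ℝ X]

/-- The slice `S(φ, α) = {x ∈ B_X : φ x > 1 - α}` of the closed unit ball. -/
def slice (φ : StrongDual ℝ X) (α : ℝ) : Set X :=
  {x | x ∈ Metric.closedBall (0 : X) 1 ∧ 1 - α < φ x}

/-- A slice of the unit ball is a set `S(φ, α)` with `φ` of norm one and `α > 0`. -/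
def IsSlice (S : Set X) : Prop :=
  ∃ (φ : StrongDual ℝ X) (α : ℝ), ‖φ‖ = 1 ∧ 0 < α ∧ S = slice φ α

variable (X) in
/-- The strong diameter 2 property: every convex combination `∑ λ_i S_i` (Minkowski sum) of
slices of the unit ball has diameter 2. -/
def HasSD2P : Prop :=
  ∀ (n : ℕ) (lam : Fin n → ℝ) (S : Fin n → Set X),
    (∀ i, 0 ≤ lam i) → ∑ i, lam i = 1 → (∀ i, IsSlice (S i)) →
      Metric.diam (∑ i, lam i • S i) = 2

end SD2P

/-! ### The Banach space `ba(X)` of bounded finitely additive signed measures -/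

/-- Bounded finitely additive signed measures on the power set of `X`. -/
structure Ba (X : Type u) extends MeasureTheory.AddContent ℝ (Set.univ : Set (Set X)) where
  bounded' : ∃ K : ℝ, ∀ A : Set X, |toFun A| ≤ K

/-- `ℓ_∞(X)` with its supremum norm. -/
abbrev EllInfty (X : Type u) : Type u := lp (fun _ : X => ℝ) ∞

namespace Ba

variable {X : Type u}

instance : CoeFun (Ba X) (fun _ => Set X → ℝ) := ⟨fun μ => μ.toFun⟩

/-- The norm `‖μ‖ = |μ|(X)`: the supremum of `∑ |μ(A_j)|` over all finite families of pairwise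
disjoint subsets of `X`. -/
noncomputable instance : Norm (Ba X) where
  norm μ := sSup {r : ℝ | ∃ P : Finset (Set X),
    (P : Set (Set X)).PairwiseDisjoint id ∧ r = ∑ A ∈ P, |μ A|}

/-- `μ` is positive. -/
def IsPositive (μ : Ba X) : Prop := ∀ A : Set X, 0 ≤ μ A

theorem sum_abs_le_norm (μ : Ba X) (P : Finset (Set X))
    (hP : (P : Set (Set X)).PairwiseDisjoint id) : ∑ A ∈ P, |μ A| ≤ ‖μ‖ := by
  classical
  refine le_csSup ?_ ⟨P, hP, rfl⟩
  obtain ⟨K, hK⟩ := μ.bounded'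
  refine ⟨K + K, ?_⟩
  rintro r ⟨Q, hQ, rfl⟩
  rw [← Finset.sum_filter_add_sum_filter_not Q (fun A : Set X => 0 ≤ μ A)]
  have key : ∀ R : Finset (Set X), R ⊆ Q → |∑ A ∈ R, μ A| ≤ K := by
    intro R hR
    have h := μ.sUnion' R (Set.subset_univ _) (hQ.subset (by exact_mod_cast hR))
      (Set.mem_univ _)
    rw [← h]
    exact hK _
  refine add_le_add ?_ ?_
  · rw [Finset.sum_congr rfl fun A hA => abs_of_nonneg (Finset.mem_filter.1 hA).2]
    exact (le_abs_self _).trans (key _ (Finset.filter_subset _ _))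
  · rw [Finset.sum_congr rfl fun A hA => abs_of_neg (not_le.1 (Finset.mem_filter.1 hA).2),
      Finset.sum_neg_distrib]
    exact (neg_le_abs _).trans (key _ (Finset.filter_subset _ _))

/-- Simple functions: real functions on `X` with finitely many values. -/
abbrev Simple (X : Type u) : Type u := @MeasureTheory.SimpleFunc X ⊤ ℝ

/-- The finite set of values of a simple function. -/
noncomputable abbrev values (s : Simple X) : Finset ℝ := @MeasureTheory.SimpleFunc.range X ℝ ⊤ s

theorem exists_of_mem_values {s : Simple X} {c : ℝ} (hc : c ∈ values s) : ∃ x, s x = c :=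
  (@MeasureTheory.SimpleFunc.mem_range X ℝ ⊤ s c).1 hc

/-- The integral of a simple function: `∑_c c * μ {x | s x = c}`. -/
noncomputable def simpleIntegral (μ : Ba X) (s : Simple X) : ℝ :=
  ∑ c ∈ values s, c * μ (s ⁻¹' {c})

theorem simpleIntegral_eq (μ : Ba X) (s : Simple X) :
    μ.simpleIntegral s = MeasureTheory.SimpleFunc.setToSimpleFunc
      (fun A => μ A • ContinuousLinearMap.id ℝ ℝ) s := by
  simp [simpleIntegral, values, MeasureTheory.SimpleFunc.setToSimpleFunc, mul_comm]

theorem finMeasAdditive (μ : Ba X) :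
    MeasureTheory.FinMeasAdditive (0 : @MeasureTheory.Measure X ⊤)
      (fun A => μ A • ContinuousLinearMap.id ℝ ℝ) := by
  intro A B _ _ _ _ hAB
  have h : μ (A ∪ B) = μ A + μ B :=
    MeasureTheory.addContent_union' (m := μ.toAddContent) (Set.mem_univ _) (Set.mem_univ _)
      (Set.mem_univ _) hAB
  simp only [h, add_smul]

/-- The integral as a linear map on simple functions. -/
noncomputable def simpleIntegralLM (μ : Ba X) : Simple X →ₗ[ℝ] ℝ where
  toFun := μ.simpleIntegral
  map_add' s t := by
    simp only [simpleIntegral_eq]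
    exact MeasureTheory.SimpleFunc.setToSimpleFunc_add _ μ.finMeasAdditive
      (MeasureTheory.integrable_zero_measure) (MeasureTheory.integrable_zero_measure)
  map_smul' c s := by
    simp only [simpleIntegral_eq]
    exact MeasureTheory.SimpleFunc.setToSimpleFunc_smul_real _ μ.finMeasAdditive c
      (MeasureTheory.integrable_zero_measure)

theorem memℓp_simple (s : Simple X) : Memℓp (fun x : X => s x) ∞ :=
  memℓp_infty (((@MeasureTheory.SimpleFunc.finite_range X ℝ ⊤ s).image (fun c => ‖c‖)).bddAbove.mono (by
    rintro _ ⟨x, rfl⟩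
    exact ⟨s x, ⟨x, rfl⟩, rfl⟩))

/-- The inclusion of the simple functions into `ℓ_∞(X)`. -/
noncomputable def simpleToEll : Simple X →ₗ[ℝ] EllInfty X where
  toFun s := ⟨fun x => s x, memℓp_simple s⟩
  map_add' _ _ := rfl
  map_smul' _ _ := rfl

theorem norm_simpleIntegral_le (μ : Ba X) (s : Simple X) :
    ‖μ.simpleIntegralLM s‖ ≤ ‖μ‖ * ‖simpleToEll s‖ := by
  classical
  have h1 : ∀ c ∈ values s, |c * μ (s ⁻¹' {c})| ≤ |μ (s ⁻¹' {c})| * ‖simpleToEll s‖ := by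
    intro c hc
    obtain ⟨x, rfl⟩ := exists_of_mem_values hc
    rw [abs_mul, mul_comm]
    exact mul_le_mul_of_nonneg_left (lp.norm_apply_le_norm ENNReal.top_ne_zero (simpleToEll s) x)
      (abs_nonneg _)
  have hinj : Set.InjOn (fun c : ℝ => s ⁻¹' {c}) (values s : Set ℝ) := by
    intro c hc d _ h
    obtain ⟨x, rfl⟩ := exists_of_mem_values hc
    have : x ∈ s ⁻¹' {d} := by
      rw [← show s ⁻¹' {s x} = s ⁻¹' {d} from h]; simp
    exact this
  have h2 : ∑ c ∈ values s, |μ (s ⁻¹' {c})| ≤ ‖μ‖ := by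
    rw [← Finset.sum_image (f := fun A => |μ A|) hinj]
    refine μ.sum_abs_le_norm _ ?_
    intro A hA B hB hAB
    simp only [Finset.coe_image, Set.mem_image] at hA hB
    obtain ⟨c, _, rfl⟩ := hA
    obtain ⟨d, _, rfl⟩ := hB
    refine Set.disjoint_left.2 fun x hx hx' => hAB ?_
    have e1 : s x = c := hx
    have e2 : s x = d := hx'
    rw [← e1, ← e2]
  calc ‖μ.simpleIntegralLM s‖ ≤ ∑ c ∈ values s, |c * μ (s ⁻¹' {c})| :=
        Finset.abs_sum_le_sum_abs _ _
    _ ≤ ∑ c ∈ values s, |μ (s ⁻¹' {c})| * ‖simpleToEll s‖ := Finset.sum_le_sum h1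
    _ = (∑ c ∈ values s, |μ (s ⁻¹' {c})|) * ‖simpleToEll s‖ := by rw [Finset.sum_mul]
    _ ≤ ‖μ‖ * ‖simpleToEll s‖ := mul_le_mul_of_nonneg_right h2 (norm_nonneg _)

theorem denseRange_simpleToEll : DenseRange (simpleToEll : Simple X →ₗ[ℝ] EllInfty X) := by
  intro f
  refine Metric.mem_closure_iff.2 fun ε hε => ?_
  have hδ : 0 < ε / 2 := half_pos hε
  have hfin : (Set.range fun x => (⌊f x / (ε / 2)⌋ : ℤ)).Finite := by
    refine (Set.finite_Icc (⌊-‖f‖ / (ε / 2)⌋ : ℤ) ⌊‖f‖ / (ε / 2)⌋).subset ?_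
    rintro _ ⟨x, rfl⟩
    have hx := abs_le.1 (lp.norm_apply_le_norm ENNReal.top_ne_zero f x)
    exact ⟨Int.floor_le_floor (div_le_div_of_nonneg_right hx.1 hδ.le),
      Int.floor_le_floor (div_le_div_of_nonneg_right hx.2 hδ.le)⟩
  let s : Simple X := @MeasureTheory.SimpleFunc.mk X ⊤ ℝ
    (fun x => (ε / 2) * (⌊f x / (ε / 2)⌋ : ℤ)) (fun _ => trivial)
    ((hfin.image (fun k : ℤ => (ε / 2) * (k : ℝ))).subset (by
      rintro _ ⟨x, rfl⟩
      exact ⟨_, ⟨x, rfl⟩, rfl⟩))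
  refine ⟨simpleToEll s, ⟨s, rfl⟩, ?_⟩
  rw [dist_eq_norm]
  refine lt_of_le_of_lt (lp.norm_le_of_forall_le hδ.le fun x => ?_) (half_lt_self hε)
  have hval : (f - simpleToEll s) x = f x - (ε / 2) * (⌊f x / (ε / 2)⌋ : ℤ) := rfl
  rw [hval]
  have e : f x = (ε / 2) * (f x / (ε / 2)) := by field_simp
  have h1 := Int.floor_le (f x / (ε / 2))
  have h2 := (Int.lt_floor_add_one (f x / (ε / 2))).le
  have h3 := mul_le_mul_of_nonneg_left h1 hδ.le
  have h4 := mul_le_mul_of_nonneg_left h2 hδ.le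
  rw [Real.norm_eq_abs, abs_le]
  constructor <;> nlinarith

/-- The integral `f ↦ ∫ f dμ` on `ℓ_∞(X)`: the unique continuous linear extension of the integral
of simple functions, which are uniformly dense in `ℓ_∞(X)`. -/
noncomputable def integral (μ : Ba X) : StrongDual ℝ (EllInfty X) :=
  μ.simpleIntegralLM.extendOfNorm simpleToEll

theorem integral_simple (μ : Ba X) (s : Simple X) :
    μ.integral (simpleToEll s) = ∑ c ∈ values s, c * μ (s ⁻¹' {c}) :=
  LinearMap.extendOfNorm_eq denseRange_simpleToEll ⟨‖μ‖, μ.norm_simpleIntegral_le⟩ s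

theorem norm_integral_apply_le (μ : Ba X) (f : EllInfty X) : ‖μ.integral f‖ ≤ ‖μ‖ * ‖f‖ :=
  LinearMap.norm_extendOfNorm_apply_le denseRange_simpleToEll _ μ.norm_simpleIntegral_le f

end Ba

/-! ### The space `Lip_0(M)` -/

/-- The set of ordered pairs of distinct points of `M`. -/
abbrev OffDiag (M : Type u) : Type u := {p : M × M // p.1 ≠ p.2}

variable {M : Type u} [MetricSpace M]

/-- The linear space of Lipschitz functions on `M` that vanish at the base point `o`. -/
def lipSubmodule (o : M) : Submodule ℝ (M → ℝ) where
  carrier := {f | f o = 0 ∧ ∃ K : ℝ≥0, LipschitzWith K f}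
  zero_mem' := ⟨rfl, 0, LipschitzWith.const 0⟩
  add_mem' := by
    rintro f g ⟨hf, K, hK⟩ ⟨hg, L, hL⟩
    exact ⟨by simp [hf, hg], K + L, hK.add hL⟩
  smul_mem' := by
    rintro c f ⟨hf, K, hK⟩
    refine ⟨by simp [hf], ‖c‖₊ * K, ?_⟩
    exact (lipschitzWith_smul c).comp hK

/-- The space `Lip_0(M)` of the pointed metric space `(M, o)`. -/
def Lip0 (o : M) : Type u := lipSubmodule o

namespace Lip0

variable {o : M}

instance : CoeFun (Lip0 o) (fun _ => M → ℝ) := ⟨fun f => f.1⟩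

noncomputable instance : AddCommGroup (Lip0 o) := inferInstanceAs (AddCommGroup (lipSubmodule o))

noncomputable instance : Module ℝ (Lip0 o) := inferInstanceAs (Module ℝ (lipSubmodule o))

/-- The norm of `Lip_0(M)` is the best Lipschitz constant. -/
noncomputable instance : Norm (Lip0 o) where
  norm f := ⨆ p : OffDiag M, |f p.1.1 - f p.1.2| / dist p.1.1 p.1.2

theorem memℓp_slope (f : Lip0 o) :
    Memℓp (fun p : OffDiag M => (f p.1.1 - f p.1.2) / dist p.1.1 p.1.2) ∞ := by
  obtain ⟨K, hK⟩ := f.2.2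
  refine memℓp_infty ⟨K, ?_⟩
  rintro _ ⟨p, rfl⟩
  have hd : 0 < dist p.1.1 p.1.2 := dist_pos.2 p.2
  simp only [Real.norm_eq_abs, abs_div, abs_of_pos hd]
  rw [div_le_iff₀ hd, ← Real.dist_eq]
  exact hK.dist_le_mul _ _

/-- De Leeuw's map `f ↦ f̃`, `f̃(x, y) = (f x - f y) / d(x, y)`, as a linear map. -/
noncomputable def deLeeuwLM : Lip0 o →ₗ[ℝ] EllInfty (OffDiag M) where
  toFun f := ⟨fun p => (f p.1.1 - f p.1.2) / dist p.1.1 p.1.2, memℓp_slope f⟩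
  map_add' f g := by
    ext p
    change ((f p.1.1 + g p.1.1) - (f p.1.2 + g p.1.2)) / _
      = (f p.1.1 - f p.1.2) / _ + (g p.1.1 - g p.1.2) / _
    ring
  map_smul' c f := by
    ext p
    change (c * f p.1.1 - c * f p.1.2) / _ = c * ((f p.1.1 - f p.1.2) / _)
    ring

theorem norm_deLeeuwLM (f : Lip0 o) : ‖deLeeuwLM f‖ = ‖f‖ := by
  rw [lp.norm_eq_ciSup]
  refine iSup_congr fun p => ?_
  change |(f p.1.1 - f p.1.2) / dist p.1.1 p.1.2| = _
  rw [abs_div, abs_of_nonneg dist_nonneg]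

theorem core : NormedSpace.Core ℝ (Lip0 o) where
  norm_nonneg f := by rw [← norm_deLeeuwLM]; exact norm_nonneg _
  norm_smul c f := by
    simp only [← norm_deLeeuwLM, map_smul]; exact norm_smul _ _
  norm_triangle f g := by
    simp only [← norm_deLeeuwLM, map_add]; exact norm_add_le _ _
  norm_eq_zero_iff f := by
    rw [← norm_deLeeuwLM, norm_eq_zero]
    refine ⟨fun h => Subtype.ext (funext fun x => ?_), fun h => by rw [h, map_zero]⟩
    change f x = 0
    by_cases hx : x = o
    · rw [hx]; exact f.2.1
    · have h' : (deLeeuwLM f) ⟨(x, o), hx⟩ = 0 := by rw [h]; rfl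
      change (f x - f o) / dist x o = 0 at h'
      rw [f.2.1, sub_zero] at h'
      exact (div_eq_zero_iff.1 h').resolve_right (dist_ne_zero.2 hx)

noncomputable instance : NormedAddCommGroup (Lip0 o) := NormedAddCommGroup.ofCore core

noncomputable instance : NormedSpace ℝ (Lip0 o) := NormedSpace.ofCore core

/-- De Leeuw's map `Φ : Lip_0(M) → ℓ_∞(M̃)`, a linear isometry. -/
noncomputable def deLeeuw (o : M) : Lip0 o →ₗᵢ[ℝ] EllInfty (OffDiag M) where
  toLinearMap := deLeeuwLM
  norm_map' := norm_deLeeuwLM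

/-- The adjoint of de Leeuw's map: `(Φ^* μ)(f) = ∫ f̃ dμ`. -/
noncomputable def deLeeuwAdjoint (o : M) (μ : Ba (OffDiag M)) : StrongDual ℝ (Lip0 o) :=
  μ.integral.comp (deLeeuw o).toContinuousLinearMap

/-- The evaluation functional `δ_x(f) = f x`. -/
noncomputable def delta (o x : M) : StrongDual ℝ (Lip0 o) :=
  LinearMap.mkContinuous
    { toFun := fun f => f x
      map_add' := fun _ _ => rfl
      map_smul' := fun _ _ => rfl } (dist x o) (fun f => by
    change |f x| ≤ dist x o * ‖f‖
    by_cases hx : x = o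
    · rw [hx, f.2.1]; simp
    · have h := lp.norm_apply_le_norm ENNReal.top_ne_zero (deLeeuwLM f) ⟨(x, o), hx⟩
      rw [norm_deLeeuwLM] at h
      change |(f x - f o) / dist x o| ≤ _ at h
      have hd : 0 < dist x o := dist_pos.2 hx
      rw [f.2.1, sub_zero, abs_div, abs_of_pos hd, div_le_iff₀ hd] at h
      linarith)

/-- The molecule `m_{x,y} = (δ_x - δ_y) / d(x, y)`, for a pair `(x, y)` of distinct points. -/
noncomputable def molecule (o : M) (p : OffDiag M) : StrongDual ℝ (Lip0 o) :=
  (dist p.1.1 p.1.2)⁻¹ • (delta o p.1.1 - delta o p.1.2)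

theorem molecule_apply (p : OffDiag M) (f : Lip0 o) :
    molecule o p f = (f p.1.1 - f p.1.2) / dist p.1.1 p.1.2 := by
  change (dist p.1.1 p.1.2)⁻¹ * (f p.1.1 - f p.1.2) = _
  rw [div_eq_inv_mul]

end Lip0

/-- `μ` is optimal: it is positive and `‖Φ^* μ‖ = ‖μ‖`. -/
def IsOptimal (o : M) (μ : Ba (OffDiag M)) : Prop :=
  μ.IsPositive ∧ ‖Lip0.deLeeuwAdjoint o μ‖ = ‖μ‖

/-- `π(A)`: the set of all points of `M` that occur in a pair belonging to `A`. -/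
def proj (A : Set (OffDiag M)) : Set M :=
  {x | ∃ p ∈ A, x = p.1.1 ∨ x = p.1.2}

end LipSD2P

/-! By Hahn–Banach every norm-one functional on `Lip0 o` is `Φ^* μ` with `μ` optimal of norm one
(`Lip0.exists_optimal`), so slices can be indexed by such `μ`. Up to constants, a function of the
unit ball lies in a thin slice of `Φ^* μ` exactly when its slopes are near 1 off a set of small
`μ`-measure (`measure_slope_lt_le`, `mem_slice_of_slope`).

If SD2P holds, two nearly antipodal averages of slice elements `F i`, `G i` have a difference that
is steep at some pair `u, v`. No summand can then fall far short, so all `F i` and `G i` have almost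
maximal, opposite increments there (`exists_common_increment`). The Lipschitz bound turns these
increments into the metric inequality.

Conversely, the metric inequality is what is needed to keep `f i` on `proj (A i)` and re-extend it
with an increment of at least `γ * dist u v` from `u` to `v` (`exists_extension_increment`);
likewise for `g i` from `v` to `u`. The slopes on `A i` are unchanged, so the new functions stay in
the slices. As `u, v` do not depend on `i`, any convex combinations of them are at distance at least
`2 * γ`. -/

namespace LipSD2P

universe u

/-! ### Positive finitely additive measures and their integrals -/

namespace Ba

variable {X : Type u}

/-- The indicator function of a set, as a simple function. -/
noncomputable def indSimple (A : Set X) : Simple X :=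
  @MeasureTheory.SimpleFunc.piecewise X ℝ ⊤ A trivial
    (@MeasureTheory.SimpleFunc.const X ℝ ⊤ 1) (@MeasureTheory.SimpleFunc.const X ℝ ⊤ 0)

/-- The indicator function of a set, as an element of `ℓ_∞(X)`. -/
noncomputable def ind (A : Set X) : EllInfty X := simpleToEll (indSimple A)

theorem ind_apply (A : Set X) (x : X) : ind A x = A.indicator (fun _ => (1 : ℝ)) x := by
  classical
  change indSimple A x = _
  simp only [indSimple, Set.indicator]
  congr

theorem ind_of_mem {A : Set X} {x : X} (h : x ∈ A) : ind A x = 1 := by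
  rw [ind_apply, Set.indicator_of_mem h]

theorem ind_of_notMem {A : Set X} {x : X} (h : x ∉ A) : ind A x = 0 := by
  rw [ind_apply, Set.indicator_of_notMem h]

theorem ind_nonneg (A : Set X) (x : X) : 0 ≤ ind A x := by
  by_cases h : x ∈ A
  · rw [ind_of_mem h]; exact zero_le_one
  · rw [ind_of_notMem h]

theorem ind_empty : ind (∅ : Set X) = 0 := by
  ext x
  rw [ind_of_notMem (Set.notMem_empty x)]; rfl

theorem ind_sUnion (P : Finset (Set X)) (hP : (P : Set (Set X)).PairwiseDisjoint id) :
    ind (⋃₀ (P : Set (Set X))) = ∑ A ∈ P, ind A := by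
  ext x
  rw [lp.coeFn_sum, Finset.sum_apply]
  by_cases hx : x ∈ ⋃₀ (P : Set (Set X))
  · obtain ⟨A, hA, hxA⟩ := hx
    rw [ind_of_mem (Set.mem_sUnion.2 ⟨A, hA, hxA⟩), Finset.sum_eq_single_of_mem A hA, ind_of_mem hxA]
    intro B hB hBA
    exact ind_of_notMem fun hxB => Set.disjoint_left.1 (hP hB hA hBA) hxB hxA
  · rw [ind_of_notMem hx, Finset.sum_eq_zero]
    exact fun A hA => ind_of_notMem fun hxA => hx ⟨A, hA, hxA⟩

theorem mem_values (s : Simple X) (x : X) : s x ∈ values s :=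
  (@MeasureTheory.SimpleFunc.mem_range X ℝ ⊤ s _).2 ⟨x, rfl⟩

theorem simpleToEll_eq_sum (s : Simple X) :
    simpleToEll s = ∑ c ∈ values s, c • ind (s ⁻¹' {c}) := by
  ext x
  rw [lp.coeFn_sum, Finset.sum_apply,
    Finset.sum_eq_single_of_mem (s x) (mem_values s x)]
  · change s x = s x * ind (s ⁻¹' {s x}) x
    rw [ind_of_mem (A := s ⁻¹' {s x}) rfl, mul_one]
  · intro c _ hc
    change c * ind (s ⁻¹' {c}) x = 0
    rw [ind_of_notMem (A := s ⁻¹' {c}) fun h => hc (Eq.symm h), mul_zero]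

theorem integral_ind (μ : Ba X) (A : Set X) : μ.integral (ind A) = μ A := by
  have h := MeasureTheory.SimpleFunc.setToSimpleFunc_indicator
    (fun A => μ A • ContinuousLinearMap.id ℝ ℝ)
    (by simp only [show μ ∅ = 0 from μ.empty', zero_smul]) (m := ⊤) (s := A) trivial (1 : ℝ)
  rw [ind, integral_simple]
  change μ.simpleIntegral _ = _
  rw [simpleIntegral_eq]
  refine h.trans ?_
  simp

theorem union_apply (μ : Ba X) {A B : Set X} (h : Disjoint A B) : μ (A ∪ B) = μ A + μ B :=
  MeasureTheory.addContent_union' (m := μ.toAddContent) (Set.mem_univ _) (Set.mem_univ _)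
      (Set.mem_univ _) h

theorem compl_apply (μ : Ba X) (A : Set X) : μ Aᶜ = μ Set.univ - μ A := by
  rw [← Set.union_compl_self A, μ.union_apply disjoint_compl_right]; ring

theorem IsPositive.mono {μ : Ba X} (hμ : μ.IsPositive) {A B : Set X} (h : A ⊆ B) :
    μ A ≤ μ B := by
  rw [← Set.union_sdiff_cancel h, μ.union_apply Set.disjoint_sdiff_right]
  exact le_add_of_nonneg_right (hμ _)

theorem IsPositive.apply_union_le {μ : Ba X} (hμ : μ.IsPositive) (A B : Set X) :
    μ (A ∪ B) ≤ μ A + μ B := by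
  rw [← Set.union_sdiff_self, μ.union_apply Set.disjoint_sdiff_right]
  gcongr
  exact hμ.mono Set.sdiff_subset

theorem IsPositive.norm_eq {μ : Ba X} (hμ : μ.IsPositive) : ‖μ‖ = μ Set.univ := by
  apply le_antisymm
  · refine csSup_le ⟨0, ∅, by simp, by simp⟩ ?_
    rintro _ ⟨P, hP, rfl⟩
    rw [Finset.sum_congr rfl fun A _ => abs_of_nonneg (hμ A),
      ← μ.sUnion' P (Set.subset_univ _) hP (Set.mem_univ _)]
    exact hμ.mono (Set.subset_univ _)
  · have h := μ.sum_abs_le_norm {Set.univ} (by simp)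
    rw [Finset.sum_singleton] at h
    exact (le_abs_self _).trans h

theorem IsPositive.integral_nonneg {μ : Ba X} (hμ : μ.IsPositive) {f : EllInfty X}
    (hf : ∀ x, 0 ≤ f x) : 0 ≤ μ.integral f := by
  have hm : 0 ≤ μ Set.univ := hμ _
  refine le_of_forall_pos_le_add fun ε hε => ?_
  -- The mass enters twice: the approximating `s` may dip to `-δ`, and replacing `f` by `s` costs
  -- another `δ`. The `+ 1` covers total mass zero.
  set δ := ε / (2 * μ Set.univ + 1) with hδ
  have hδ0 : 0 < δ := by positivity
  obtain ⟨_, ⟨s, rfl⟩, hs⟩ := Metric.mem_closure_iff.1 (denseRange_simpleToEll f) δ hδ0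
  rw [dist_eq_norm] at hs
  have hsx : ∀ x, -δ ≤ s x := fun x => by
    have h := (abs_le.1 ((lp.norm_apply_le_norm ENNReal.top_ne_zero (f - simpleToEll s) x).trans
      hs.le)).2
    change f x - s x ≤ δ at h
    linarith [hf x]
  have hsum : ∑ c ∈ values s, μ (s ⁻¹' {c}) ≤ μ Set.univ := by
    have h := map_sum μ.integral (fun c => ind (s ⁻¹' {c})) (values s)
    simp only [integral_ind] at h
    rw [← h, ← integral_ind]
    refine le_of_eq (congrArg _ ?_)
    ext x
    rw [lp.coeFn_sum, Finset.sum_apply, ind_of_mem (Set.mem_univ x),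
      Finset.sum_eq_single_of_mem (s x) (mem_values s x),
      ind_of_mem (A := s ⁻¹' {s x}) rfl]
    exact fun c _ hc => ind_of_notMem (A := s ⁻¹' {c}) fun h => hc (Eq.symm h)
  have h1 : -δ * μ Set.univ ≤ μ.integral (simpleToEll s) := by
    rw [integral_simple]
    calc -δ * μ Set.univ ≤ -δ * ∑ c ∈ values s, μ (s ⁻¹' {c}) := by nlinarith
      _ = ∑ c ∈ values s, -δ * μ (s ⁻¹' {c}) := Finset.mul_sum _ _ _
      _ ≤ _ := Finset.sum_le_sum fun c hc => by
        obtain ⟨x, rfl⟩ := exists_of_mem_values hc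
        exact mul_le_mul_of_nonneg_right (hsx x) (hμ _)
  have h2 := (abs_le.1 (μ.norm_integral_apply_le (f - simpleToEll s))).1
  rw [map_sub, hμ.norm_eq] at h2
  have h3 : δ * (2 * μ Set.univ + 1) = ε := by rw [hδ]; field_simp
  nlinarith [mul_le_mul_of_nonneg_left hs.le hm]

theorem IsPositive.integral_mono {μ : Ba X} (hμ : μ.IsPositive) {f g : EllInfty X}
    (h : ∀ x, f x ≤ g x) : μ.integral f ≤ μ.integral g := by
  have := hμ.integral_nonneg (f := g - f) fun x => sub_nonneg.2 (h x)
  rwa [map_sub, sub_nonneg] at this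

/-- A Markov type inequality: a function bounded above by `1` whose integral is nearly the total
mass is nearly `1` off a set of small mass. -/
theorem IsPositive.mul_apply_lt_le {μ : Ba X} (hμ : μ.IsPositive) {f : EllInfty X}
    (hf : ∀ x, f x ≤ 1) (γ : ℝ) :
    (1 - γ) * μ {x | f x < γ} ≤ μ Set.univ - μ.integral f := by
  have h := hμ.integral_mono (f := f) (g := ind Set.univ - (1 - γ) • ind {x | f x < γ}) fun x => by
    change f x ≤ ind Set.univ x - (1 - γ) * ind {x | f x < γ} x
    rw [ind_of_mem (Set.mem_univ x)]
    by_cases hx : f x < γ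
    · rw [ind_of_mem (A := {x | f x < γ}) hx]; linarith
    · rw [ind_of_notMem (A := {x | f x < γ}) hx]; linarith [hf x]
  rw [map_sub, map_smul, integral_ind, integral_ind, smul_eq_mul] at h
  linarith

/-- Integrate the pointwise bound `γ • 1_A - 1_{Aᶜ} ≤ f`. -/
theorem IsPositive.le_integral {μ : Ba X} (hμ : μ.IsPositive) {f : EllInfty X}
    (hf : ∀ x, -1 ≤ f x) {γ : ℝ} {A : Set X} (hA : ∀ x ∈ A, γ ≤ f x) :
    γ * μ A - (μ Set.univ - μ A) ≤ μ.integral f := by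
  have h := hμ.integral_mono (f := γ • ind A - ind Aᶜ) (g := f) fun x => by
    change γ * ind A x - ind Aᶜ x ≤ f x
    by_cases hx : x ∈ A
    · rw [ind_of_mem hx, ind_of_notMem (A := Aᶜ) (not_not.2 hx)]; linarith [hA x hx]
    · rw [ind_of_notMem hx, ind_of_mem (A := Aᶜ) hx]; linarith [hf x]
  rwa [map_sub, map_smul, integral_ind, integral_ind, smul_eq_mul, compl_apply] at h

/-- The finitely additive measure `A ↦ ψ(1_A)` defined by a functional `ψ` on `ℓ_∞(X)`. -/
noncomputable def ofDual (ψ : StrongDual ℝ (EllInfty X)) : Ba X where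
  toFun A := ψ (ind A)
  empty' := by rw [ind_empty, map_zero]
  sUnion' P _ hP _ := by rw [ind_sUnion P hP, map_sum]
  bounded' := by
    refine ⟨‖ψ‖, fun A => (ψ.le_opNorm _).trans (mul_le_of_le_one_right (norm_nonneg _) ?_)⟩
    refine lp.norm_le_of_forall_le zero_le_one fun x => ?_
    by_cases h : x ∈ A
    · rw [ind_of_mem h, norm_one]
    · rw [ind_of_notMem h, norm_zero]; exact zero_le_one

theorem ofDual_apply (ψ : StrongDual ℝ (EllInfty X)) (A : Set X) : ofDual ψ A = ψ (ind A) := rfl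

/-- Both sides are continuous and agree on indicators, hence on the dense set of simple functions.
-/
theorem integral_ofDual (ψ : StrongDual ℝ (EllInfty X)) : (ofDual ψ).integral = ψ := by
  refine DFunLike.coe_injective (denseRange_simpleToEll.equalizer
    (ofDual ψ).integral.continuous ψ.continuous (funext fun s => ?_))
  change (ofDual ψ).integral (simpleToEll s) = ψ (simpleToEll s)
  rw [simpleToEll_eq_sum, map_sum, map_sum]
  refine Finset.sum_congr rfl fun c _ => ?_
  rw [map_smul, map_smul, integral_ind, ofDual_apply]

end Ba

/-! ### Optimal measures representing functionals on `Lip_0` -/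

/-- A positive functional of norm at most one on `ℓ_∞` extending a functional that is dominated by
the supremum. -/
theorem exists_dual_le_iSup {X : Type u} [Nonempty X] {E : Type u} [AddCommGroup E] [Module ℝ E]
    (T : E →ₗ[ℝ] EllInfty X) (hT : Function.Injective T) (φ : E →ₗ[ℝ] ℝ)
    (h : ∀ e, φ e ≤ ⨆ x, T e x) :
    ∃ ψ : StrongDual ℝ (EllInfty X), (∀ e, ψ (T e) = φ e) ∧ ∀ f, ψ f ≤ ⨆ x, f x := by
  have hb : ∀ f : EllInfty X, BddAbove (Set.range fun x => f x) := fun f => ⟨‖f‖, by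
    rintro _ ⟨x, rfl⟩
    exact (le_abs_self _).trans (lp.norm_apply_le_norm ENNReal.top_ne_zero f x)⟩
  let e := LinearEquiv.ofInjective T hT
  -- The majorant is the supremum, not the norm: this one-sided bound is what makes the extension
  -- positive.
  obtain ⟨g, hg1, hg2⟩ := exists_extension_of_le_sublinear
    ⟨LinearMap.range T, φ.comp e.symm.toLinearMap⟩ (fun f : EllInfty X => ⨆ x, f x)
    (fun c hc f => (Real.mul_iSup_of_nonneg hc.le fun x => f x).symm)
    (fun f f' => ciSup_le fun x => add_le_add (le_ciSup (hb f) x) (le_ciSup (hb f') x))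
    (fun f => by
      have h' := h (e.symm f)
      have h2 : T (e.symm f) = f := congrArg Subtype.val (e.apply_symm_apply f)
      rw [h2] at h'
      exact h')
  have hle : ∀ f, g f ≤ 1 * ‖f‖ := fun f => by
    rw [one_mul]
    refine (hg2 f).trans (ciSup_le fun x => ?_)
    exact (le_abs_self _).trans (lp.norm_apply_le_norm ENNReal.top_ne_zero f x)
  refine ⟨g.mkContinuous 1 fun f => abs_le.2 ⟨?_, hle f⟩, fun x => ?_, hg2⟩
  · have := hle (-f)
    rw [map_neg, norm_neg] at this
    linarith
  · have h1 : g (T x) = φ (e.symm (e x)) := hg1 (e x)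
    rw [e.symm_apply_apply] at h1
    exact h1

variable {M : Type u} [MetricSpace M]

namespace Lip0

variable {o : M}

theorem deLeeuw_apply (f : Lip0 o) (p : OffDiag M) :
    deLeeuw o f p = (f p.1.1 - f p.1.2) / dist p.1.1 p.1.2 := rfl

theorem molecule_eq (f : Lip0 o) (p : OffDiag M) : molecule o p f = deLeeuw o f p := by
  rw [molecule_apply, deLeeuw_apply]

theorem sub_le (f : Lip0 o) (x y : M) : f x - f y ≤ ‖f‖ * dist x y := by
  by_cases h : x = y
  · simp [h]
  · have h1 := (le_abs_self _).trans
      (lp.norm_apply_le_norm ENNReal.top_ne_zero (deLeeuw o f) ⟨(x, y), h⟩)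
    rw [LinearIsometry.norm_map, deLeeuw_apply, div_le_iff₀ (dist_pos.2 h)] at h1
    exact h1

theorem norm_le_of_forall {f : Lip0 o} {c : ℝ} (hc : 0 ≤ c)
    (h : ∀ x y, f x - f y ≤ c * dist x y) : ‖f‖ ≤ c := by
  rw [← (deLeeuw o).norm_map]
  refine lp.norm_le_of_forall_le hc fun p => ?_
  have hp : 0 < dist p.1.1 p.1.2 := dist_pos.2 p.2
  rw [deLeeuw_apply, Real.norm_eq_abs, abs_div, abs_of_pos hp, div_le_iff₀ hp, abs_le]
  have h1 := h p.1.2 p.1.1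
  rw [dist_comm] at h1
  exact ⟨by linarith, h _ _⟩

theorem norm_le_one_iff {f : Lip0 o} : ‖f‖ ≤ 1 ↔ ∀ x y, f x - f y ≤ dist x y := by
  refine ⟨fun h x y => (f.sub_le x y).trans (mul_le_of_le_one_left dist_nonneg h), fun h => ?_⟩
  exact norm_le_of_forall zero_le_one fun x y => by rw [one_mul]; exact h x y

theorem abs_deLeeuw_le_one {f : Lip0 o} (h : ‖f‖ ≤ 1) (p : OffDiag M) :
    |deLeeuw o f p| ≤ 1 := by
  refine (lp.norm_apply_le_norm ENNReal.top_ne_zero (deLeeuw o f) p).trans ?_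
  rwa [LinearIsometry.norm_map]

/-- Swapping the two points changes the sign of the slope, so the supremum of the slopes is already
that of their absolute values. This supplies the domination needed for the positive extension. -/
theorem le_iSup_deLeeuw [Nonempty (OffDiag M)] (f : Lip0 o) : ‖f‖ ≤ ⨆ p, deLeeuw o f p := by
  rw [← (deLeeuw o).norm_map]
  have hb : BddAbove (Set.range fun p => deLeeuw o f p) := ⟨‖deLeeuw o f‖, by
    rintro _ ⟨x, rfl⟩
    exact (le_abs_self _).trans (lp.norm_apply_le_norm ENNReal.top_ne_zero (deLeeuw o f) x)⟩
  refine lp.norm_le_of_forall_le' _ fun p => abs_le'.2 ⟨le_ciSup hb p, ?_⟩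
  refine le_trans (le_of_eq ?_) (le_ciSup hb ⟨(p.1.2, p.1.1), p.2.symm⟩)
  rw [deLeeuw_apply, deLeeuw_apply, dist_comm, ← neg_div, neg_sub]

theorem sum_apply {ι : Type*} (s : Finset ι) (F : ι → Lip0 o) (x : M) :
    (∑ i ∈ s, F i) x = ∑ i ∈ s, F i x :=
  map_sum (delta o x) F s

theorem smul_apply (c : ℝ) (f : Lip0 o) (x : M) : (c • f) x = c * f x := rfl

theorem sub_apply (f g : Lip0 o) (x : M) : (f - g) x = f x - g x := rfl

/-- A function with Lipschitz constant one, normalised to vanish at the base point. -/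
def ofSubLe (o : M) (h : M → ℝ) (hh : ∀ x y, h x - h y ≤ dist x y) : Lip0 o :=
  ⟨fun x => h x - h o, sub_self _, 1, LipschitzWith.of_dist_le_mul fun x y => by
    rw [NNReal.coe_one, one_mul, Real.dist_eq, abs_le]
    have h1 := hh y x
    rw [dist_comm] at h1
    constructor <;> linarith [hh x y]⟩

theorem ofSubLe_sub (h : M → ℝ) (hh : ∀ x y, h x - h y ≤ dist x y) (x y : M) :
    ofSubLe o h hh x - ofSubLe o h hh y = h x - h y :=
  sub_sub_sub_cancel_right _ _ _

/-- Every functional of norm one on `Lip_0(M)` is represented by an optimal measure of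
norm one. -/
theorem exists_optimal (φ : StrongDual ℝ (Lip0 o)) (hφ : ‖φ‖ = 1) :
    ∃ μ : Ba (OffDiag M), IsOptimal o μ ∧ ‖μ‖ = 1 ∧ deLeeuwAdjoint o μ = φ := by
  -- On a one-point space `Lip0 o` is trivial and carries no functional of norm one.
  have hne : Nonempty (OffDiag M) := by
    by_contra hemp
    rw [not_nonempty_iff] at hemp
    have hz : φ = 0 := by
      ext f
      have hf : ‖f‖ ≤ 0 := norm_le_of_forall le_rfl fun x y => by
        by_cases hxy : x = y
        · simp [hxy]
        · exact (hemp.false ⟨(x, y), hxy⟩).elim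
      rw [norm_le_zero_iff.1 hf, map_zero, map_zero]
    rw [hz, norm_zero] at hφ
    exact zero_ne_one hφ
  obtain ⟨ψ, hψ, hle⟩ := exists_dual_le_iSup (deLeeuw o).toLinearMap (deLeeuw o).injective
    φ.toLinearMap fun f => by
      refine le_trans ?_ (le_iSup_deLeeuw f)
      have h := (le_abs_self _).trans (φ.le_opNorm f)
      rwa [hφ, one_mul] at h
  have hpos : (Ba.ofDual ψ).IsPositive := fun A => by
    rw [Ba.ofDual_apply]
    have h := (hle (-Ba.ind A)).trans (ciSup_le (c := 0) fun p => neg_nonpos.2 (Ba.ind_nonneg A p))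
    rw [map_neg] at h
    linarith
  have hadj : deLeeuwAdjoint o (Ba.ofDual ψ) = φ := by
    ext f
    change (Ba.ofDual ψ).integral (deLeeuw o f) = φ f
    rw [Ba.integral_ofDual]
    exact hψ f
  have hnorm : ‖Ba.ofDual ψ‖ = 1 := by
    apply le_antisymm
    · rw [hpos.norm_eq, Ba.ofDual_apply]
      exact (hle _).trans (ciSup_le fun p => (Ba.ind_of_mem (Set.mem_univ p)).le)
    · rw [← hφ, ← hadj]
      have h0 : 0 ≤ ‖Ba.ofDual ψ‖ := by rw [hpos.norm_eq]; exact hpos _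
      refine ContinuousLinearMap.opNorm_le_bound _ h0 fun f => ?_
      rw [← (deLeeuw o).norm_map]
      exact Ba.norm_integral_apply_le _ _
  exact ⟨_, ⟨hpos, by rw [hadj, hnorm, hφ]⟩, hnorm, hadj⟩

end Lip0

/-! ### Lipschitz extensions with a large increment -/

/-- McShane's extension of prescribed values `c i` at the points `p i`. -/
theorem exists_extension {ι : Type*} [Nonempty ι] (p : ι → M) (c : ι → ℝ)
    (h : ∀ i j, c i - c j ≤ dist (p i) (p j)) :
    ∃ F : M → ℝ, (∀ x y, F x - F y ≤ dist x y) ∧ (∀ i, F (p i) = c i) ∧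
      ∀ b z, (∀ i, b ≤ c i + dist (p i) z) → b ≤ F z := by
  obtain ⟨k⟩ := ‹Nonempty ι›
  have hb : ∀ z, BddBelow (Set.range fun i => c i + dist (p i) z) := fun z =>
    ⟨c k - dist (p k) z, by
      rintro _ ⟨i, rfl⟩
      have h1 := h k i
      have h2 := dist_triangle_right (p k) (p i) z
      change _ ≤ c i + dist (p i) z
      linarith⟩
  have : Nonempty ι := ⟨k⟩
  -- The infimum of cones is the largest extension; the last conclusion records this maximality.
  refine ⟨fun z => ⨅ i, c i + dist (p i) z, fun x y => ?_, fun i => ?_, fun b z hz =>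
    le_ciInf hz⟩
  · rw [sub_le_comm]
    refine le_ciInf fun i => ?_
    have h1 := ciInf_le (hb x) i
    have h2 := dist_triangle_right (p i) x y
    linarith
  · refine le_antisymm ?_ (le_ciInf fun j => ?_)
    · simpa using ciInf_le (hb (p i)) i
    · have h1 := h i j
      rw [dist_comm] at h1
      linarith

/-- A function on `S` with Lipschitz constant one extends to `M` with a large increment from `u` to
`v`. -/
theorem exists_extension_increment {S : Set M} (hS : S.Nonempty) (f : M → ℝ)
    (hf : ∀ x y, f x - f y ≤ dist x y) (u v : M) {r : ℝ} (hr : r ≤ dist u v)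
    (h : ∀ x ∈ S, ∀ y ∈ S, f x - f y + r ≤ dist x u + dist y v) :
    ∃ F : M → ℝ, (∀ x y, F x - F y ≤ dist x y) ∧ (∀ x ∈ S, F x = f x) ∧ r ≤ F v - F u := by
  have : Nonempty S := hS.to_subtype
  have hb : BddAbove (Set.range fun x : S => f x - dist (x : M) u) := ⟨f u, by
    rintro _ ⟨x, rfl⟩
    have h1 := hf x u
    change f x - dist (x : M) u ≤ _
    linarith⟩
  -- The least value at `u` compatible with `f` on `S`. Combined with the largest extension, it
  -- makes the increment from `u` to `v` as large as possible. If `u ∈ S`, then `a = f u`, so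
  -- nothing conflicts.
  set a := ⨆ x : S, f x - dist (x : M) u with ha
  have ha1 : ∀ x ∈ S, f x - dist x u ≤ a := fun x hx => le_ciSup hb ⟨x, hx⟩
  have ha2 : a ≤ f u := ciSup_le fun x => by linarith [hf x u]
  obtain ⟨F, hF1, hF2, hF3⟩ := exists_extension (ι := Option S)
    (fun i => i.elim u (fun x => (x : M))) (fun i => i.elim a (fun x => f x)) (by
      rintro (_ | x) (_ | y)
      · simp
      · have h1 := hf u y
        change a - f y ≤ dist u y
        linarith
      · have h1 := ha1 x x.2
        change f x - a ≤ dist (x : M) u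
        linarith
      · exact hf x y)
  refine ⟨F, hF1, fun x hx => hF2 (some ⟨x, hx⟩), ?_⟩
  have hu : F u = a := hF2 none
  rw [hu, le_sub_iff_add_le]
  -- The cone at `u` lies above the bound at `v` by `hr`, the cones at points of `S` by the metric
  -- inequality `h`.
  refine hF3 _ _ ?_
  rintro (_ | y)
  · change r + a ≤ a + dist u v
    linarith
  · change r + a ≤ f y + dist (y : M) v
    have h1 : a ≤ f y + dist (y : M) v - r := ciSup_le fun x => by
      linarith [h x x.2 y y.2]
    linarith

/-- The `Lip_0` form of the extension, for a set of pairs on which the slopes are kept. -/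
theorem exists_lip0_increment {o : M} {A : Set (OffDiag M)} (hA : A.Nonempty) {f : Lip0 o}
    (hf : ‖f‖ ≤ 1) (u v : M) {r : ℝ} (hr : r ≤ dist u v)
    (h : ∀ x ∈ proj A, ∀ y ∈ proj A, f x - f y + r ≤ dist x u + dist y v) :
    ∃ F : Lip0 o, ‖F‖ ≤ 1 ∧ (∀ p ∈ A, Lip0.deLeeuw o F p = Lip0.deLeeuw o f p) ∧
      r ≤ F v - F u := by
  obtain ⟨p, hp⟩ := hA
  obtain ⟨F, hF1, hF2, hF3⟩ := exists_extension_increment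
    (S := proj A) ⟨p.1.1, p, hp, Or.inl rfl⟩ f
    (Lip0.norm_le_one_iff.1 hf) u v hr h
  -- Subtracting `F o` changes no increment.
  refine ⟨Lip0.ofSubLe o F hF1, Lip0.norm_le_one_iff.2 fun x y => ?_, fun q hq => ?_, ?_⟩
  · rw [Lip0.ofSubLe_sub]; exact hF1 x y
  · rw [Lip0.deLeeuw_apply, Lip0.deLeeuw_apply, Lip0.ofSubLe_sub, hF2 _ ⟨q, hq, Or.inl rfl⟩,
      hF2 _ ⟨q, hq, Or.inr rfl⟩]
  · rw [Lip0.ofSubLe_sub]; exact hF3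

/-! ### Convex combinations of subsets of the unit ball -/

section SD2P

variable {X : Type u} [NormedAddCommGroup X] [NormedSpace ℝ X]

theorem mem_sum_smul {n : ℕ} {lam : Fin n → ℝ} {S : Fin n → Set X} {x : X} :
    x ∈ ∑ i, lam i • S i ↔ ∃ F : Fin n → X, (∀ i, F i ∈ S i) ∧ ∑ i, lam i • F i = x := by
  rw [Set.mem_fintype_sum]
  constructor
  · rintro ⟨g, hg, rfl⟩
    choose F hF hFg using fun i => Set.mem_smul_set.1 (hg i)
    exact ⟨F, hF, Finset.sum_congr rfl fun i _ => hFg i⟩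
  · rintro ⟨F, hF, rfl⟩
    exact ⟨_, fun i => Set.smul_mem_smul_set (hF i), rfl⟩

theorem sum_smul_subset_closedBall {n : ℕ} {lam : Fin n → ℝ} (h0 : ∀ i, 0 ≤ lam i)
    (h1 : ∑ i, lam i = 1) {S : Fin n → Set X} (hS : ∀ i, S i ⊆ Metric.closedBall 0 1) :
    ∑ i, lam i • S i ⊆ Metric.closedBall 0 1 := by
  intro x hx
  obtain ⟨F, hF, rfl⟩ := mem_sum_smul.1 hx
  exact (convex_closedBall (0 : X) 1).sum_mem (fun i _ => h0 i) h1 fun i _ => hS i (hF i)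

theorem diam_sum_smul_le {n : ℕ} {lam : Fin n → ℝ} (h0 : ∀ i, 0 ≤ lam i)
    (h1 : ∑ i, lam i = 1) {S : Fin n → Set X} (hS : ∀ i, S i ⊆ Metric.closedBall 0 1) :
    Metric.diam (∑ i, lam i • S i) ≤ 2 :=
  (Metric.diam_mono (sum_smul_subset_closedBall h0 h1 hS) Metric.isBounded_closedBall).trans
    ((Metric.diam_closedBall zero_le_one).trans_eq (mul_one 2))

end SD2P

/-! ### Slices of optimal measures and the two implications -/

variable {o : M}

theorem IsOptimal.norm_deLeeuwAdjoint {μ : Ba (OffDiag M)} (h : IsOptimal o μ ∧ ‖μ‖ = 1) :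
    ‖Lip0.deLeeuwAdjoint o μ‖ = 1 := h.1.2.trans h.2

theorem IsOptimal.apply_univ {μ : Ba (OffDiag M)} (h : IsOptimal o μ ∧ ‖μ‖ = 1) :
    μ Set.univ = 1 := h.1.1.norm_eq.symm.trans h.2

/-- Elements of a thin slice have large slope off a set of small measure. -/
theorem measure_slope_lt_le {μ : Ba (OffDiag M)} (h : IsOptimal o μ ∧ ‖μ‖ = 1) {α γ : ℝ}
    {f : Lip0 o} (hf : f ∈ slice (Lip0.deLeeuwAdjoint o μ) α) :
    (1 - γ) * μ {p | Lip0.deLeeuw o f p < γ} ≤ α := by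
  have h1 := h.1.1.mul_apply_lt_le (f := Lip0.deLeeuw o f) (fun p => (abs_le.1
    (Lip0.abs_deLeeuw_le_one (mem_closedBall_zero_iff.1 hf.1) p)).2) γ
  have h2 : 1 - α < μ.integral (Lip0.deLeeuw o f) := hf.2
  rw [IsOptimal.apply_univ h] at h1
  linarith

/-- The integral is at least `(1 + γ) * μ A - 1 ≥ γ + γ ^ 2 - 1`, which misses 1 by at most `(1 - γ)
* (2 + γ) < 3 * (1 - γ)`. -/
theorem mem_slice_of_slope {μ : Ba (OffDiag M)} (h : IsOptimal o μ ∧ ‖μ‖ = 1) {α γ : ℝ}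
    (hγ0 : 0 < γ) (hγ1 : γ < 1) (hα : 3 * (1 - γ) ≤ α) {A : Set (OffDiag M)} (hA : γ ≤ μ A)
    {f : Lip0 o} (hf : ‖f‖ ≤ 1) (hfA : ∀ p ∈ A, γ ≤ Lip0.deLeeuw o f p) :
    f ∈ slice (Lip0.deLeeuwAdjoint o μ) α := by
  refine ⟨mem_closedBall_zero_iff.2 hf, ?_⟩
  have h1 := h.1.1.le_integral (fun p => (abs_le.1 (Lip0.abs_deLeeuw_le_one hf p)).1) hfA
  rw [IsOptimal.apply_univ h] at h1
  change _ < μ.integral (Lip0.deLeeuw o f)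
  nlinarith [mul_pos (sub_pos.2 hγ1) (sub_pos.2 hγ1)]

/-- If the average of functions in the unit ball has norm nearly `2`, then some pair of points
witnesses this for each of the functions. -/
theorem exists_common_increment {n : ℕ} (hn : 0 < n) {γ : ℝ} (hγ0 : 0 < γ) {F G : Fin n → Lip0 o}
    (hF : ∀ i, ‖F i‖ ≤ 1) (hG : ∀ i, ‖G i‖ ≤ 1)
    (h : 2 - (1 - γ) / n < ‖∑ i, (n : ℝ)⁻¹ • F i - ∑ i, (n : ℝ)⁻¹ • G i‖) :
    ∃ u v : M, u ≠ v ∧ ∀ i, γ * dist u v ≤ F i v - F i u ∧ γ * dist u v ≤ G i u - G i v := by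
  have hn' : (0 : ℝ) < n := Nat.cast_pos.2 hn
  have hc : 0 ≤ 2 - (1 - γ) / n := by
    have h1 : (1 : ℝ) ≤ n := Nat.one_le_cast.2 hn
    have h2 : (1 - γ) / n ≤ 1 := (div_le_one hn').2 (by linarith)
    linarith
  obtain ⟨v, u, hvu⟩ : ∃ v u : M, (2 - (1 - γ) / n) * dist v u <
      (∑ i, (n : ℝ)⁻¹ • F i - ∑ i, (n : ℝ)⁻¹ • G i) v
        - (∑ i, (n : ℝ)⁻¹ • F i - ∑ i, (n : ℝ)⁻¹ • G i) u := by
    by_contra hcon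
    push Not at hcon
    exact h.not_ge (Lip0.norm_le_of_forall hc hcon)
  refine ⟨u, v, fun huv => ?_, fun i => ?_⟩
  · rw [huv, dist_self, mul_zero, sub_self] at hvu
    exact hvu.false
  have hF1 := fun j => Lip0.norm_le_one_iff.1 (hF j) v u
  have hG1 := fun j => Lip0.norm_le_one_iff.1 (hG j) u v
  rw [dist_comm v u] at hvu
  simp only [dist_comm v u] at hF1
  -- All deficits from `2 * dist u v` are nonnegative, so each is at most their sum, which is below
  -- `(1 - γ) * dist u v`. As either increment is at most `dist u v`, the other is at least `γ *
  -- dist u v`.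
  have hsingle : 2 * dist u v - ((F i v - F i u) + (G i u - G i v)) ≤
      ∑ j, (2 * dist u v - ((F j v - F j u) + (G j u - G j v))) :=
    Finset.single_le_sum (f := fun j => 2 * dist u v - ((F j v - F j u) + (G j u - G j v)))
      (fun j _ => by linarith [hF1 j, hG1 j]) (Finset.mem_univ i)
  have hsum : (n : ℝ)⁻¹ * ∑ j, ((F j v - F j u) + (G j u - G j v)) =
      (∑ i, (n : ℝ)⁻¹ • F i - ∑ i, (n : ℝ)⁻¹ • G i) v
        - (∑ i, (n : ℝ)⁻¹ • F i - ∑ i, (n : ℝ)⁻¹ • G i) u := by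
    simp only [Lip0.sub_apply, Lip0.sum_apply, Lip0.smul_apply, Finset.mul_sum,
      ← Finset.sum_sub_distrib]
    exact Finset.sum_congr rfl fun j _ => by ring
  rw [← hsum, ← mul_lt_mul_iff_right₀ hn', mul_inv_cancel_left₀ hn'.ne'] at hvu
  have hexp : (n : ℝ) * ((2 - (1 - γ) / n) * dist u v) =
      n * (2 * dist u v) - (1 - γ) * dist u v := by
    field_simp
  rw [Finset.sum_sub_distrib, Finset.sum_const, Finset.card_univ, Fintype.card_fin,
    nsmul_eq_mul] at hsingle
  constructor <;> linarith [hF1 i, hG1 i]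

/-- Large increments of `f` and `g` between `u` and `v`, in opposite directions, yield the metric
inequality for all pairs of points. -/
theorem max_add_le_of_increment {f g : Lip0 o} (hf : ‖f‖ ≤ 1) (hg : ‖g‖ ≤ 1) {u v : M} {r : ℝ}
    (hfr : r ≤ f v - f u) (hgr : r ≤ g u - g v) (x y : M) :
    max (f x - f y) (g y - g x) + r ≤ dist x u + dist y v := by
  have hf' := Lip0.norm_le_one_iff.1 hf
  have hg' := Lip0.norm_le_one_iff.1 hg
  have h1 := hf' v y
  have h2 := hg' u x
  rw [dist_comm] at h1 h2
  rw [← le_sub_iff_add_le]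
  exact max_le (by linarith [hf' x u]) (by linarith [hg' y v])

/-- Equal weights `1 / n` suffice: with them, near-extremality of the average passes to every index
with the same loss. -/
theorem exists_of_hasSD2P (h : HasSD2P (Lip0 o)) {n : ℕ} (hn : 0 < n)
    {μ : Fin n → Ba (OffDiag M)} (hμ : ∀ i, IsOptimal o (μ i) ∧ ‖μ i‖ = 1) {γ : ℝ}
    (hγ0 : 0 < γ) (hγ1 : γ < 1) :
    ∃ (F G : Fin n → Lip0 o) (u v : M), (∀ i, ‖F i‖ ≤ 1 ∧ ‖G i‖ ≤ 1) ∧ u ≠ v ∧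
      (∀ i, γ ≤ μ i {p | γ ≤ Lip0.deLeeuw o (F i) p ∧ γ ≤ Lip0.deLeeuw o (G i) p}) ∧
      ∀ i x y, max (F i x - F i y) (G i y - G i x) + γ * dist u v ≤ dist x u + dist y v := by
  have hn' : (0 : ℝ) < n := Nat.cast_pos.2 hn
  have hγ : 0 < 1 - γ := sub_pos.2 hγ1
  -- By the Markov inequality each set where a slope is below `γ` then has mass at most `(1 - γ) /
  -- 2`, so the two sets for `F i` and `G i` together have mass at most `1 - γ`.
  set α := (1 - γ) * ((1 - γ) / 2) with hα
  have hα0 : 0 < α := by positivity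
  have hdiam := h n (fun _ => (n : ℝ)⁻¹) (fun i => slice (Lip0.deLeeuwAdjoint o (μ i)) α)
    (fun _ => by positivity) (by simp [hn'.ne'])
    (fun i => ⟨_, α, IsOptimal.norm_deLeeuwAdjoint (hμ i), hα0, rfl⟩)
  -- The `max` with 0 is there because a bound on the diameter has to be nonnegative.
  obtain ⟨a, ha, b, hb, hab⟩ : ∃ a ∈ ∑ i, (n : ℝ)⁻¹ • slice (Lip0.deLeeuwAdjoint o (μ i)) α,
      ∃ b ∈ ∑ i, (n : ℝ)⁻¹ • slice (Lip0.deLeeuwAdjoint o (μ i)) α,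
        max 0 (2 - (1 - γ) / n) < dist a b := by
    by_contra hcon
    push Not at hcon
    have h1 := Metric.diam_le_of_forall_dist_le (le_max_left _ _) hcon
    rw [hdiam] at h1
    refine h1.not_gt (max_lt two_pos ?_)
    linarith [div_pos hγ hn']
  obtain ⟨F, hF, rfl⟩ := mem_sum_smul.1 ha
  obtain ⟨G, hG, rfl⟩ := mem_sum_smul.1 hb
  have hF1 := fun i => mem_closedBall_zero_iff.1 (hF i).1
  have hG1 := fun i => mem_closedBall_zero_iff.1 (hG i).1
  rw [dist_eq_norm] at hab
  obtain ⟨u, v, huv, hinc⟩ := exists_common_increment hn hγ0 hF1 hG1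
    ((le_max_right _ _).trans_lt hab)
  refine ⟨F, G, u, v, fun i => ⟨hF1 i, hG1 i⟩, huv, fun i => ?_, fun i =>
    max_add_le_of_increment (hF1 i) (hG1 i) (hinc i).1 (hinc i).2⟩
  have hsmall : ∀ f ∈ slice (Lip0.deLeeuwAdjoint o (μ i)) α,
      μ i {p | Lip0.deLeeuw o f p < γ} ≤ (1 - γ) / 2 := fun f hf =>
    le_of_mul_le_mul_left (measure_slope_lt_le (hμ i) hf) hγ
  have hcompl := (μ i).compl_apply
    {p | γ ≤ Lip0.deLeeuw o (F i) p ∧ γ ≤ Lip0.deLeeuw o (G i) p}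
  have hle := (hμ i).1.1.apply_union_le {p | Lip0.deLeeuw o (F i) p < γ}
    {p | Lip0.deLeeuw o (G i) p < γ}
  rw [show {p | Lip0.deLeeuw o (F i) p < γ} ∪ {p | Lip0.deLeeuw o (G i) p < γ} =
    {p | γ ≤ Lip0.deLeeuw o (F i) p ∧ γ ≤ Lip0.deLeeuw o (G i) p}ᶜ by
      ext p
      simp only [Set.mem_union, Set.mem_ofPred_eq, Set.mem_compl_iff, not_and_or, not_le],
    hcompl, IsOptimal.apply_univ (hμ i)] at hle
  linarith [hsmall _ (hF i), hsmall _ (hG i)]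

/-- Functions of the slices which have large increments in opposite directions. -/
theorem exists_mem_slice_increment {μ : Ba (OffDiag M)} (h : IsOptimal o μ ∧ ‖μ‖ = 1) {α γ : ℝ}
    (hγ0 : 0 < γ) (hγ1 : γ < 1) (hα : 3 * (1 - γ) ≤ α) {A : Set (OffDiag M)} (hA : γ ≤ μ A)
    {f : Lip0 o} (hf : ‖f‖ ≤ 1) (hfA : ∀ p ∈ A, γ ≤ Lip0.deLeeuw o f p) {u v : M}
    (hfuv : ∀ x ∈ proj A, ∀ y ∈ proj A, f x - f y + γ * dist u v ≤ dist x u + dist y v) :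
    ∃ F ∈ slice (Lip0.deLeeuwAdjoint o μ) α, γ * dist u v ≤ F v - F u := by
  have hne : A.Nonempty := by
    rw [Set.nonempty_iff_ne_empty]
    rintro rfl
    rw [show μ ∅ = 0 from μ.empty'] at hA
    exact hγ0.not_ge hA
  obtain ⟨F, hF1, hF2, hF3⟩ := exists_lip0_increment hne hf u v
    (mul_le_of_le_one_left dist_nonneg hγ1.le) hfuv
  exact ⟨F, mem_slice_of_slope h hγ0 hγ1 hα hA hF1 fun p hp => (hF2 p hp).symm ▸ hfA p hp, hF3⟩

/-- Each `F i - G i` grows by at least `2 * γ * dist u v` from `u` to `v`. The pair is common to all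
`i`, so the bound survives averaging with any weights. -/
theorem two_mul_le_diam {n : ℕ} {lam : Fin n → ℝ} (h0 : ∀ i, 0 ≤ lam i) (h1 : ∑ i, lam i = 1)
    {S : Fin n → Set (Lip0 o)} (hS : ∀ i, S i ⊆ Metric.closedBall 0 1) {u v : M} (huv : u ≠ v)
    {γ : ℝ} {F G : Fin n → Lip0 o} (hF : ∀ i, F i ∈ S i) (hG : ∀ i, G i ∈ S i)
    (hFuv : ∀ i, γ * dist u v ≤ F i v - F i u) (hGuv : ∀ i, γ * dist u v ≤ G i u - G i v) :
    2 * γ ≤ Metric.diam (∑ i, lam i • S i) := by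
  refine le_trans ?_ (Metric.dist_le_diam_of_mem
    (Metric.isBounded_closedBall.subset (sum_smul_subset_closedBall h0 h1 hS))
    (mem_sum_smul.2 ⟨F, hF, rfl⟩) (mem_sum_smul.2 ⟨G, hG, rfl⟩))
  rw [dist_eq_norm]
  refine le_of_mul_le_mul_right ?_ (dist_pos.2 huv)
  rw [dist_comm u v]
  refine le_trans ?_ (Lip0.sub_le _ v u)
  simp only [Lip0.sub_apply, Lip0.sum_apply, Lip0.smul_apply, ← Finset.sum_sub_distrib]
  calc 2 * γ * dist v u = ∑ i, lam i * (2 * γ * dist v u) := by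
        rw [← Finset.sum_mul, h1, one_mul]
    _ ≤ _ := Finset.sum_le_sum fun i _ => by
        have h2 := mul_le_mul_of_nonneg_left (add_le_add (hFuv i) (hGuv i)) (h0 i)
        rw [dist_comm u v] at h2
        linarith

end LipSD2P

theorem proposition3p7 {M : Type*} [MetricSpace M] (o : M) :
    LipSD2P.HasSD2P (LipSD2P.Lip0 o) ↔
      ∀ (n : ℕ), 0 < n → ∀ (μ : Fin n → LipSD2P.Ba (LipSD2P.OffDiag M)),
        (∀ i, LipSD2P.IsOptimal o (μ i) ∧ ‖μ i‖ = 1) →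
        ∀ γ : ℝ, γ ∈ Set.Ioo (0 : ℝ) 1 →
          ∃ (A : Fin n → Set (LipSD2P.OffDiag M)) (f g : Fin n → LipSD2P.Lip0 o) (u v : M),
            (∀ i, γ ≤ μ i (A i)) ∧
            (∀ i, f i ∈ Metric.closedBall (0 : LipSD2P.Lip0 o) 1 ∧
              g i ∈ Metric.closedBall (0 : LipSD2P.Lip0 o) 1) ∧
            u ≠ v ∧
            (∀ i, ∀ p ∈ A i,
              γ ≤ LipSD2P.Lip0.molecule o p (f i) ∧ γ ≤ LipSD2P.Lip0.molecule o p (g i)) ∧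
            (∀ i, ∀ x ∈ LipSD2P.proj (A i), ∀ y ∈ LipSD2P.proj (A i),
              max (f i x - f i y) (g i y - g i x) + γ * dist u v ≤ dist x u + dist y v) := by
  constructor
  · intro h n hn μ hμ γ hγ
    obtain ⟨F, G, u, v, hFG, huv, hA, hmax⟩ :=
      LipSD2P.exists_of_hasSD2P h hn hμ hγ.1 hγ.2
    -- `A i` is read off from `hA`: the pairs at which both slopes are at least `γ`.
    refine ⟨_, F, G, u, v, hA, fun i => ⟨mem_closedBall_zero_iff.2 (hFG i).1,
      mem_closedBall_zero_iff.2 (hFG i).2⟩, huv, fun i p hp => ?_, fun i x _ y _ => hmax i x y⟩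
    rw [LipSD2P.Lip0.molecule_eq, LipSD2P.Lip0.molecule_eq]
    exact hp
  · intro h n lam S h0 h1 hS
    choose φ α hφ hα hSφ using hS
    choose μ hopt hμ hadj using fun i => LipSD2P.Lip0.exists_optimal (φ i) (hφ i)
    obtain rfl : S = fun i => LipSD2P.slice (LipSD2P.Lip0.deLeeuwAdjoint o (μ i)) (α i) := by
      funext i
      rw [hSφ, hadj]
    have hn : 0 < n := by
      rw [Nat.pos_iff_ne_zero]
      rintro rfl
      simp at h1
    have hball : ∀ i, LipSD2P.slice (LipSD2P.Lip0.deLeeuwAdjoint o (μ i)) (α i) ⊆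
        Metric.closedBall 0 1 := fun i f hf => hf.1
    refine le_antisymm (LipSD2P.diam_sum_smul_le h0 h1 hball) ?_
    refine le_of_forall_pos_le_add fun ε hε => ?_
    obtain ⟨k, -, hk⟩ := Finset.exists_min_image Finset.univ α ⟨⟨0, hn⟩, Finset.mem_univ _⟩
    -- With `γ = 1 - δ`: `δ < 1` gives `γ > 0`, `δ < ε / 2` gives `2 * γ > 2 - ε`, and `δ < α k /
    -- 3`, with `α k` minimal, gives `3 * (1 - γ) ≤ α i` for all `i`.
    obtain ⟨δ, hδ0, hδ⟩ := exists_between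
      (lt_min one_pos (lt_min (half_pos hε) (div_pos (hα k) three_pos)))
    rw [lt_min_iff, lt_min_iff] at hδ
    obtain ⟨hδ1, hδε, hδα⟩ := hδ
    have hthin : ∀ i, 3 * (1 - (1 - δ)) ≤ α i := fun i => by
      have := hk i (Finset.mem_univ i)
      linarith
    obtain ⟨A, f, g, u, v, hA, hfg, huv, hm, hmax⟩ := h n hn μ (fun i => ⟨hopt i, hμ i⟩) (1 - δ)
      ⟨by linarith, by linarith⟩
    simp only [LipSD2P.Lip0.molecule_eq] at hm
    choose F hF hFuv using fun i => LipSD2P.exists_mem_slice_increment ⟨hopt i, hμ i⟩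
      (sub_pos.2 hδ1) (by linarith) (hthin i) (hA i) (mem_closedBall_zero_iff.1 (hfg i).1)
      (fun p hp => (hm i p hp).1) (u := u) (v := v) fun x hx y hy =>
        (add_le_add_left (le_max_left _ _) _).trans (hmax i x hx y hy)
    -- For `g` the increment runs from `v` to `u`, so the metric inequality is used with `x` and `y`
    -- exchanged.
    choose G hG hGuv using fun i => LipSD2P.exists_mem_slice_increment ⟨hopt i, hμ i⟩
      (sub_pos.2 hδ1) (by linarith) (hthin i) (hA i) (mem_closedBall_zero_iff.1 (hfg i).2)
      (fun p hp => (hm i p hp).2) (u := v) (v := u) fun x hx y hy => by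
        rw [dist_comm v u, add_comm (dist x v)]
        exact (add_le_add_left (le_max_right _ _) _).trans (hmax i y hy x hx)
    have hdiam := LipSD2P.two_mul_le_diam h0 h1 hball huv hF hG hFuv fun i => by
      rw [dist_comm]; exact hGuv i
    linarith
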